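/- A base station with $L$ antennas serves a finite set $\Psi$ of user groups at once, with $Q$ users in each group. User $(\psi,k)$, $\psi\in\Psi$, $k\in\{1,\dots,Q\}$, has $M_{\psi,k}$ receive antennas and is sent $M_{\psi,k}$ symbols $s_{\psi,k,q}$, $1\le q\le M_{\psi,k}$, with (channel-independent) powers $P_{\psi,k,q}\ge 0$; the symbols are independent with mean $0$ and unit power. Let $\mathbf H_{\psi,k}\in\mathbb C^{L\times M_{\psi,k}}$ be the channel matrix of user $(\psi,k)$, $\mathbf H_\psi=[\mathbf H_{\psi,1},\dots,\mathbf H_{\psi,Q}]$ and $M_\psi=\sum_{k=1}^{Q} M_{\psi,k}$. The fading is independent Rayleigh fading with pathloss: all entries of all channel matrices are independent, and those of $\mathbf H_{\psi,k}$ are circularly symmetric complex Gaussian with mean $0$ and variance $\beta_{\psi,k}>0$. Under zero-forcing (ZF) precoding the base station transmits $\mathbf x=\sum_{\psi\in\Psi}\mathbf V_\psi\mathbf P_\psi\mathbf s_\psi$, where $\mathbf s_\psi$ collects the symbols of group $\psi$ (ordered as the columns of $\mathbf H_\psi$), $\mathbf P_\psi$ is the diagonal matrix of the corresponding $\sqrt{P_{\psi,k,q}}$,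 and $\mathbf V_\psi$ is $\mathbf H_\psi^*(\mathbf H_\psi^T\mathbf H_\psi^*)^{-1}$ with its $j$-th column multiplied by $\big([(\mathbf H_\psi^T\mathbf H_\psi^*)^{-1}]_{j,j}\big)^{-1/2}$ ($^*$ is entrywise conjugation). User $(\psi,k)$ receives $\mathbf H_{\psi,k}^T\mathbf x+\mathbf z_{\psi,k}$ with $\mathbf z_{\psi,k}\sim\mathcal{CN}(\mathbf 0,N_0\mathbf I)$, $N_0>0$, independent of the symbols, removes the contribution of the other groups (which it knows from its cache and the composite channel state), and decodes $s_{\psi,k,q}$ from the $q$-th entry of the result; let $\mathrm{SINR}_{\psi,k,q}$ be the corresponding signal-to-interference-plus-noise ratio, where the interference consists of all other symbols. Let $T>0$ be the coherence block length and $\Theta$ the number of pilot symbols per receive antenna, and suppose that $\xi=1-\frac{\Theta}{T}\sum_{\psi\in\Psi}\sum_{k=1}^{Q}M_{\psi,k}\ge 0$. The effective rate of user $(\psi,k)$, averaged over the channel fading, is $$\bar R^{\rm ZF}_{\psi,k}=\mathbb E\Big\{\xi\sum_{q=1}^{M_{\psi,k}}\ln\big(1+\mathrm{SINR}_{\psi,k,q}\big)\Big\}.$$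 Then, for every $\psi\in\Psi$ with $M_\psi\le L$ and every $k\in\{1,\dots,Q\}$, this expectation exists, is finite, and satisfies $$\xi\sum_{q=1}^{M_{\psi,k}}\ln\Big(1+\frac{P_{\psi,k,q}(L-M_\psi)\beta_{\psi,k}}{N_0}\Big)\;\le\;\bar R^{\rm ZF}_{\psi,k}\;\le\;\xi\sum_{q=1}^{M_{\psi,k}}\ln\Big(1+\frac{P_{\psi,k,q}(L-M_\psi+1)\beta_{\psi,k}}{N_0}\Big).$$ -/

import Mathlib

open MeasureTheory ProbabilityTheory
open scoped Matrix NNReal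

namespace VCC

noncomputable section

/-- The circularly symmetric complex Gaussian law `CN(0, v)` on `ℂ`: the real and the imaginary
part are independent real Gaussians with mean `0` and variance `v / 2`. -/
def complexGaussian (v : ℝ≥0) : Measure ℂ :=
  ((gaussianReal 0 (v / 2)).prod (gaussianReal 0 (v / 2))).map
    (fun x : ℝ × ℝ => (⟨x.1, x.2⟩ : ℂ))

/-- The symbols (streams) sent to one group, in which user `k` gets `m k` symbols: the pair
`(k, q)` stands for the `q`-th symbol of the `k`-th user. -/
abbrev Stream {Q : ℕ} (m : Fin Q → ℕ) : Type := (k : Fin Q) × Fin (m k)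

/-- All symbols sent in one transmission: a group `ψ`, a user `k` of it, and a symbol index. -/
abbrev Symbol {Ψ : Type*} {Q : ℕ} (M : Ψ → Fin Q → ℕ) : Type _ := (ψ : Ψ) × Stream (M ψ)

/-- A channel realization: the channel matrix `H ψ k` of each user, with one row for each of the
`L` transmit antennas and one column for each of the `M ψ k` receive antennas. -/
abbrev Channel {Ψ : Type*} {Q : ℕ} (L : ℕ) (M : Ψ → Fin Q → ℕ) : Type _ :=
  (ψ : Ψ) → (k : Fin Q) → Matrix (Fin L) (Fin (M ψ k)) ℂ

/-- Independent Rayleigh fading with pathloss `β ψ k`: all channel coefficients are mutually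
independent, and those of user `(ψ, k)` have the law `CN(0, β ψ k)`. -/
structure IsRayleighFading {Ω : Type*} [MeasurableSpace Ω] {Ψ : Type*} {Q L : ℕ}
    {M : Ψ → Fin Q → ℕ} (H : Ω → Channel L M) (β : Ψ → Fin Q → ℝ) (μ : Measure Ω) : Prop where
  hasLaw : ∀ (ψ : Ψ) (k : Fin Q) (l : Fin L) (q : Fin (M ψ k)),
    HasLaw (fun ω => H ω ψ k l q) (complexGaussian (β ψ k).toNNReal) μ
  indep : iIndepFun
    (fun (i : (ψ : Ψ) × (k : Fin Q) × (Fin L × Fin (M ψ k))) (ω : Ω) =>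
      H ω i.1 i.2.1 i.2.2.1 i.2.2.2) μ

/-- The channel matrix `H_ψ = [H_{ψ,1}, …, H_{ψ,Q}]` of one group. -/
def groupChannel {Q L : ℕ} {m : Fin Q → ℕ} (H : (k : Fin Q) → Matrix (Fin L) (Fin (m k)) ℂ) :
    Matrix (Fin L) (Stream m) ℂ :=
  Matrix.of fun l j => H j.1 l j.2

/-- The entrywise complex conjugate of a matrix. -/
def conjMatrix {m n : Type*} (A : Matrix m n ℂ) : Matrix m n ℂ := A.map (starRingEnd ℂ)

/-- `(H_ψᵀ H_ψ^*)⁻¹`. -/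
def invGram {Q L : ℕ} {m : Fin Q → ℕ} (H : (k : Fin Q) → Matrix (Fin L) (Fin (m k)) ℂ) :
    Matrix (Stream m) (Stream m) ℂ :=
  ((groupChannel H)ᵀ * conjMatrix (groupChannel H))⁻¹

/-- The zero-forcing precoder `V_ψ = (H_ψ^* (H_ψᵀ H_ψ^*)⁻¹) ∘ D_ψ` of one group, where all the
entries of the `j`-th column of `D_ψ` are `([(H_ψᵀ H_ψ^*)⁻¹]_{j,j}) ^ (-1/2)`. -/
def zfPrecoder {Q L : ℕ} {m : Fin Q → ℕ} (H : (k : Fin Q) → Matrix (Fin L) (Fin (m k)) ℂ) :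
    Matrix (Fin L) (Stream m) ℂ :=
  Matrix.hadamard (conjMatrix (groupChannel H) * invGram H)
    (Matrix.of fun _ j => (((invGram H j j).re ^ (-(1 / 2) : ℝ) : ℝ) : ℂ))

section System

variable {Ψ : Type*} [Fintype Ψ] [DecidableEq Ψ] {Q L : ℕ} {M : Ψ → Fin Q → ℕ}

/-- The precoded signal `V_ψ P_ψ s_ψ` of group `ψ`, where `P i` is the power of the symbol `i`. -/
def groupSignal (V : (ψ : Ψ) → Matrix (Fin L) (Stream (M ψ)) ℂ) (P : Symbol M → ℝ)
    (s : Symbol M → ℂ) (ψ : Ψ) : Fin L → ℂ :=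
  V ψ *ᵥ fun j => (Real.sqrt (P ⟨ψ, j⟩) : ℂ) * s ⟨ψ, j⟩

/-- The transmitted signal `x = ∑ ψ, V_ψ P_ψ s_ψ`. -/
def transmitSignal (V : (ψ : Ψ) → Matrix (Fin L) (Stream (M ψ)) ℂ) (P : Symbol M → ℝ)
    (s : Symbol M → ℂ) : Fin L → ℂ :=
  ∑ ψ, groupSignal V P s ψ

/-- The signal `y_{ψ,k} = H_{ψ,k}ᵀ x + z_{ψ,k}` received by user `(ψ, k)`. -/
def receivedSignal (H : Channel L M) (V : (ψ : Ψ) → Matrix (Fin L) (Stream (M ψ)) ℂ)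
    (P : Symbol M → ℝ) (s : Symbol M → ℂ) (ψ : Ψ) (k : Fin Q) (z : Fin (M ψ k) → ℂ) :
    Fin (M ψ k) → ℂ :=
  (H ψ k)ᵀ *ᵥ transmitSignal V P s + z

/-- The inter-group interference at user `(ψ, k)`: the part of the received signal that stems
from the other groups. The user knows it from its cache and from the composite channel state. -/
def interGroupInterference (H : Channel L M) (V : (ψ : Ψ) → Matrix (Fin L) (Stream (M ψ)) ℂ)
    (P : Symbol M → ℝ) (s : Symbol M → ℂ) (ψ : Ψ) (k : Fin Q) : Fin (M ψ k) → ℂ :=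
  (H ψ k)ᵀ *ᵥ ∑ φ ∈ Finset.univ.erase ψ, groupSignal V P s φ

/-- The signal from which user `(ψ, k)` decodes: the known inter-group interference is removed
from the received signal, and the decoding matrix `R` of the user is applied. -/
def decodingSignal (H : Channel L M) (V : (ψ : Ψ) → Matrix (Fin L) (Stream (M ψ)) ℂ)
    (P : Symbol M → ℝ) (s : Symbol M → ℂ) (ψ : Ψ) (k : Fin Q)
    (R : Matrix (Fin (M ψ k)) (Fin (M ψ k)) ℂ) (z : Fin (M ψ k) → ℂ) : Fin (M ψ k) → ℂ :=
  Rᴴ *ᵥ (receivedSignal H V P s ψ k z - interGroupInterference H V P s ψ k)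

/-- The coefficient of the symbol `i` in the `q`-th entry of the decoding signal of user `(ψ, k)`;
the decoding signal is linear in the symbols and the noise jointly. -/
def symbolGain (H : Channel L M) (V : (ψ : Ψ) → Matrix (Fin L) (Stream (M ψ)) ℂ)
    (P : Symbol M → ℝ) (ψ : Ψ) (k : Fin Q) (R : Matrix (Fin (M ψ k)) (Fin (M ψ k)) ℂ)
    (q : Fin (M ψ k)) (i : Symbol M) : ℂ :=
  decodingSignal H V P (Pi.single i 1) ψ k R 0 q

/-- The coefficient of the noise at receive antenna `r` in the `q`-th entry of the decoding signal
of user `(ψ, k)`. -/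
def noiseGain (H : Channel L M) (V : (ψ : Ψ) → Matrix (Fin L) (Stream (M ψ)) ℂ)
    (P : Symbol M → ℝ) (ψ : Ψ) (k : Fin Q) (R : Matrix (Fin (M ψ k)) (Fin (M ψ k)) ℂ)
    (q r : Fin (M ψ k)) : ℂ :=
  decodingSignal H V P 0 ψ k R (Pi.single r 1) q

/-- The signal-to-interference-plus-noise ratio for decoding the `q`-th symbol of user `(ψ, k)`,
for independent symbols with mean `0` and power `1` and for noise `CN(0, N₀ I)`: the power of the
contribution of that symbol, divided by the power of everything else. -/
def sinr (H : Channel L M) (V : (ψ : Ψ) → Matrix (Fin L) (Stream (M ψ)) ℂ)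
    (P : Symbol M → ℝ) (N₀ : ℝ) (ψ : Ψ) (k : Fin Q)
    (R : Matrix (Fin (M ψ k)) (Fin (M ψ k)) ℂ) (q : Fin (M ψ k)) : ℝ :=
  ‖symbolGain H V P ψ k R q ⟨ψ, k, q⟩‖ ^ 2 /
    (∑ i ∈ Finset.univ.erase (⟨ψ, k, q⟩ : Symbol M), ‖symbolGain H V P ψ k R q i‖ ^ 2
      + N₀ * ∑ r, ‖noiseGain H V P ψ k R q r‖ ^ 2)

/-- `ξ = 1 - Θ (∑ ψ, ∑ k, M_{ψ,k}) / T`: the fraction of a coherence block of `T` symbols that is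
left when `Θ` symbols per receive antenna are spent on pilots. -/
def csiFactor (M : Ψ → Fin Q → ℕ) (Θ T : ℝ) : ℝ :=
  1 - Θ * (∑ ψ, ∑ k, (M ψ k : ℝ)) / T

/-- The effective rate (in nats) of user `(ψ, k)` under zero-forcing, for a given channel
realization: every group uses the zero-forcing precoder, and the decoding matrix is `I`. -/
def zfRate (H : Channel L M) (P : Symbol M → ℝ) (N₀ Θ T : ℝ) (ψ : Ψ) (k : Fin Q) : ℝ :=
  csiFactor M Θ T *
    ∑ q, Real.log (1 + sinr H (fun φ => zfPrecoder (H φ)) P N₀ ψ k 1 q)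

/-- The effective rate of user `(ψ, k)` under zero-forcing, averaged over the channel fading. -/
def zfAverageRate {Ω : Type*} [MeasurableSpace Ω] (μ : Measure Ω) (H : Ω → Channel L M)
    (P : Symbol M → ℝ) (N₀ Θ T : ℝ) (ψ : Ψ) (k : Fin Q) : ℝ :=
  ∫ ω, zfRate (H ω) P N₀ Θ T ψ k ∂μ

/-- The lower bound `ξ ∑ q, ln (1 + P_{ψ,k,q} (L - M_ψ) β_{ψ,k} / N₀)`. -/
def zfLowerBound (L : ℕ) (β : Ψ → Fin Q → ℝ) (P : Symbol M → ℝ) (N₀ Θ T : ℝ)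
    (ψ : Ψ) (k : Fin Q) : ℝ :=
  csiFactor M Θ T *
    ∑ q : Fin (M ψ k),
      Real.log (1 + P ⟨ψ, k, q⟩ * ((L : ℝ) - (∑ k', (M ψ k' : ℝ))) * β ψ k / N₀)

/-- The upper bound `ξ ∑ q, ln (1 + P_{ψ,k,q} (L - M_ψ + 1) β_{ψ,k} / N₀)`. -/
def zfUpperBound (L : ℕ) (β : Ψ → Fin Q → ℝ) (P : Symbol M → ℝ) (N₀ Θ T : ℝ)
    (ψ : Ψ) (k : Fin Q) : ℝ :=
  csiFactor M Θ T *
    ∑ q : Fin (M ψ k),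
      Real.log (1 + P ⟨ψ, k, q⟩ * ((L : ℝ) - (∑ k', (M ψ k' : ℝ)) + 1) * β ψ k / N₀)

end System

end

end VCC

namespace VCC

open scoped ENNReal RealInnerProductSpace InnerProductSpace

/-! Zero-forcing removes all interference inside the group, so the SINR of stream `j` is `c / Y`
with `c = P / N₀` and `Y` the `j`-th diagonal entry of the inverse Gram matrix of the columns of the
group's channel (`sinr_zf`). Geometrically, `1 / Y` is the squared distance from column `j` to the
span of the other columns (`inv_gram_diag`).

Freeze the other columns. Column `j` is independent of them and its law is unitarily invariant, so
its projection to the orthogonal complement of their span is again a vector of independent `CN(0,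
β)` entries, of dimension `n = L - M_ψ + 1` (`map_orthogonalProjection_gaussianVector`,
`lintegral_inv_gram_diag_le`). The mean of `1 / Y` is therefore at most `n β`, and for `n > 1` the
mean of `Y` is at most `1 / ((n - 1) β)`.

Jensen's inequality gives both bounds: `x ↦ log (1 + c x)` is concave and is averaged over `x = 1 /
Y`; `y ↦ log (1 + c / y)` is convex and is averaged over `Y`. In tangent-line form, upper bounds on
the two means suffice, because the first function is increasing and the second decreasing. -/

/-! ### Complex Gaussian vectors and their orthogonal projections -/

lemma measurable_complex_mk : Measurable (fun x : ℝ × ℝ => (⟨x.1, x.2⟩ : ℂ)) :=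
  Complex.measurableEquivRealProd.symm.measurable

instance isProbabilityMeasure_complexGaussian (v : ℝ≥0) :
    IsProbabilityMeasure (complexGaussian v) :=
  Measure.isProbabilityMeasure_map measurable_complex_mk.aemeasurable

/-- Two independent parts of variance `v / 2` give the factor `1 / 4`. Only `‖t‖` enters, which is
the source of the unitary invariance. -/
lemma charFun_complexGaussian (v : ℝ≥0) (t : ℂ) :
    charFun (complexGaussian v) t = Complex.exp (-(v * ‖t‖ ^ 2 / 4 : ℝ)) := by
  have h : ∀ x : ℝ × ℝ, Complex.exp (⟪(⟨x.1, x.2⟩ : ℂ), t⟫_ℝ * Complex.I) =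
      Complex.exp (t.re * x.1 * Complex.I) * Complex.exp (t.im * x.2 * Complex.I) := by
    intro x
    rw [← Complex.exp_add, Complex.inner]
    congr 1
    simp
    ring
  rw [charFun_apply, complexGaussian, integral_map measurable_complex_mk.aemeasurable
    (by fun_prop)]
  simp_rw [h]
  rw [integral_prod_mul (μ := gaussianReal 0 (v / 2)) (ν := gaussianReal 0 (v / 2))
    (fun x : ℝ => Complex.exp (t.re * x * Complex.I))
    (fun x : ℝ => Complex.exp (t.im * x * Complex.I)), ← charFun_apply_real, ← charFun_apply_real,
    charFun_gaussianReal, charFun_gaussianReal, ← Complex.exp_add, Complex.sq_norm,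
    Complex.normSq_apply]
  congr 1
  push_cast
  ring

/-- The law of a vector of `n` independent `CN(0, v)` variables. -/
noncomputable def gaussianVector (n : ℕ) (v : ℝ≥0) : Measure (EuclideanSpace ℂ (Fin n)) :=
  (Measure.pi fun _ => complexGaussian v).map (WithLp.toLp 2)

instance isProbabilityMeasure_gaussianVector (n : ℕ) (v : ℝ≥0) :
    IsProbabilityMeasure (gaussianVector n v) :=
  Measure.isProbabilityMeasure_map (by fun_prop)

lemma charFun_gaussianVector (n : ℕ) (v : ℝ≥0) (t : EuclideanSpace ℂ (Fin n)) :
    charFun (gaussianVector n v) t = Complex.exp (-(v * ‖t‖ ^ 2 / 4 : ℝ)) := by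
  rw [gaussianVector, charFun_pi]
  simp_rw [charFun_complexGaussian]
  rw [← Complex.exp_sum, EuclideanSpace.norm_sq_eq]
  congr 1
  push_cast
  rw [Finset.sum_neg_distrib, Finset.mul_sum, Finset.sum_div]

/-- The coordinates of the orthogonal projection of a Gaussian vector to a subspace, in an
orthonormal basis of the subspace, form a Gaussian vector. -/
lemma map_orthogonalProjection_gaussianVector {L n : ℕ} (v : ℝ≥0)
    (K : Submodule ℂ (EuclideanSpace ℂ (Fin L))) (b : OrthonormalBasis (Fin n) ℂ K) :
    (gaussianVector L v).map (fun g => b.repr (K.orthogonalProjectionOnto g)) =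
      gaussianVector n v := by
  have hm : Measurable (fun g => b.repr (K.orthogonalProjectionOnto g)) := by fun_prop
  have := Measure.isProbabilityMeasure_map (μ := gaussianVector L v) hm.aemeasurable
  apply Measure.ext_of_charFun
  ext t
  -- The projection followed by coordinates is adjoint to the isometric embedding `b.repr.symm`, so
  -- the characteristic function at `t` is that of `g` at a vector of the same norm.
  have key : ∀ g, ⟪b.repr (K.orthogonalProjectionOnto g), t⟫_ℝ =
      ⟪g, ((b.repr.symm t : K) : EuclideanSpace ℂ (Fin L))⟫_ℝ := by
    intro g
    have h1 : ∀ {m : ℕ} (x y : EuclideanSpace ℂ (Fin m)), ⟪x, y⟫_ℝ = (⟪x, y⟫_ℂ).re := by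
      intro m x y
      simp [PiLp.inner_apply, Complex.inner]
    rw [h1, h1, ← b.repr.symm.inner_map_map]
    simp
  rw [charFun_apply, integral_map hm.aemeasurable (by fun_prop)]
  simp_rw [key]
  rw [← charFun_apply, charFun_gaussianVector, charFun_gaussianVector]
  have : ‖((b.repr.symm t : K) : EuclideanSpace ℂ (Fin L))‖ = ‖t‖ := b.repr.symm.norm_map t
  rw [this]

/-! ### Moments and Laplace transform of the squared norm -/

lemma lintegral_sq_gaussianReal (v : ℝ≥0) :
    ∫⁻ x, ENNReal.ofReal (x ^ 2) ∂(gaussianReal 0 v) = v := by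
  have h2 : MemLp id 2 (gaussianReal 0 v) := memLp_id_gaussianReal 2
  have hi : Integrable (fun x : ℝ => x ^ 2) (gaussianReal 0 v) := h2.integrable_sq
  rw [← ofReal_integral_eq_lintegral_ofReal hi (ae_of_all _ fun x => sq_nonneg x)]
  have h := variance_of_integral_eq_zero (μ := gaussianReal 0 v) (X := id) (by fun_prop) (by simp)
  rw [variance_id_gaussianReal] at h
  simp only [id] at h ⊢
  rw [← h, ENNReal.ofReal_coe_nnreal]

lemma lintegral_norm_sq_complexGaussian (v : ℝ≥0) :
    ∫⁻ z, ENNReal.ofReal (‖z‖ ^ 2) ∂(complexGaussian v) = v := by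
  rw [complexGaussian, lintegral_map (by fun_prop) measurable_complex_mk,
    lintegral_prod _ (Measurable.aemeasurable (by
      have := measurable_complex_mk
      fun_prop))]
  simp_rw [Complex.sq_norm, Complex.normSq_mk, ← sq,
    ENNReal.ofReal_add (sq_nonneg _) (sq_nonneg _)]
  simp_rw [lintegral_add_left measurable_const, lintegral_sq_gaussianReal]
  rw [lintegral_add_right _ measurable_const]
  simp only [lintegral_const, measure_univ, mul_one, lintegral_sq_gaussianReal]
  exact_mod_cast add_halves v

lemma integral_exp_neg_mul_sq_gaussianReal (v : ℝ≥0) {t : ℝ} (ht : 0 ≤ t) :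
    ∫ x, Real.exp (-(t * x ^ 2)) ∂(gaussianReal 0 v) = (√(1 + 2 * v * t))⁻¹ := by
  rcases eq_or_ne v 0 with rfl | hv
  · simp
  have hv' : (0 : ℝ) < v := by positivity
  rw [integral_gaussianReal_eq_integral_smul hv]
  have h : ∀ x : ℝ, gaussianPDFReal 0 v x • Real.exp (-(t * x ^ 2)) =
      (√(2 * Real.pi * v))⁻¹ * Real.exp (-(t + (2 * v : ℝ)⁻¹) * x ^ 2) := by
    intro x
    rw [gaussianPDFReal, smul_eq_mul, mul_assoc, ← Real.exp_add]
    congr 2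
    field_simp
    ring
  simp_rw [h]
  rw [integral_const_mul, integral_gaussian, ← Real.sqrt_inv, ← Real.sqrt_inv,
    ← Real.sqrt_mul (by positivity)]
  congr 1
  field_simp
  ring

lemma lintegral_exp_neg_norm_sq_complexGaussian (v : ℝ≥0) {t : ℝ} (ht : 0 ≤ t) :
    ∫⁻ z, ENNReal.ofReal (Real.exp (-(t * ‖z‖ ^ 2))) ∂(complexGaussian v) =
      ENNReal.ofReal (1 + v * t)⁻¹ := by
  rw [← ofReal_integral_eq_lintegral_ofReal _ (ae_of_all _ fun x => (Real.exp_pos _).le)]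
  · rw [complexGaussian, integral_map measurable_complex_mk.aemeasurable (by fun_prop)]
    simp_rw [Complex.sq_norm, Complex.normSq_mk, mul_add, neg_add, Real.exp_add, ← sq]
    rw [integral_prod_mul (μ := gaussianReal 0 (v / 2)) (ν := gaussianReal 0 (v / 2))
      (fun x : ℝ => Real.exp (-(t * x ^ 2))) (fun x : ℝ => Real.exp (-(t * x ^ 2))),
      integral_exp_neg_mul_sq_gaussianReal _ ht, ← mul_inv,
      Real.mul_self_sqrt (by positivity)]
    congr 2
    push_cast
    ring
  · refine Integrable.of_bound (by fun_prop) 1 (ae_of_all _ fun x => ?_)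
    rw [Real.norm_of_nonneg (Real.exp_pos _).le, Real.exp_le_one_iff]
    have := mul_nonneg ht (sq_nonneg ‖x‖)
    linarith

lemma lintegral_norm_sq_gaussianVector (n : ℕ) (v : ℝ≥0) :
    ∫⁻ z, ENNReal.ofReal (‖z‖ ^ 2) ∂(gaussianVector n v) = n * v := by
  rw [gaussianVector, lintegral_map (by fun_prop) (by fun_prop)]
  simp_rw [EuclideanSpace.norm_sq_eq]
  simp_rw [ENNReal.ofReal_sum_of_nonneg (fun i _ => sq_nonneg _)]
  rw [lintegral_finsetSum _ (by fun_prop)]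
  have (i : Fin n) : ∫⁻ a, ENNReal.ofReal (‖a i‖ ^ 2) ∂(Measure.pi fun _ => complexGaussian v)
      = v := by
    rw [← lintegral_norm_sq_complexGaussian v,
      ← (measurePreserving_eval (fun _ => complexGaussian v) i).lintegral_comp (by fun_prop)]
  simp only [this, Finset.sum_const, Finset.card_univ, Fintype.card_fin, nsmul_eq_mul]

lemma lintegral_exp_neg_norm_sq_gaussianVector (n : ℕ) (v : ℝ≥0) {t : ℝ} (ht : 0 ≤ t) :
    ∫⁻ z, ENNReal.ofReal (Real.exp (-(t * ‖z‖ ^ 2))) ∂(gaussianVector n v) =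
      ENNReal.ofReal ((1 + v * t)⁻¹ ^ n) := by
  rw [gaussianVector, lintegral_map (by fun_prop) (by fun_prop)]
  simp_rw [EuclideanSpace.norm_sq_eq, Finset.mul_sum, ← Finset.sum_neg_distrib, Real.exp_sum]
  simp_rw [ENNReal.ofReal_prod_of_nonneg (fun i _ => (Real.exp_pos _).le)]
  have := (iIndepFun_pi (μ := fun _ : Fin n => complexGaussian v)
    (X := fun _ z => ENNReal.ofReal (Real.exp (-(t * ‖z‖ ^ 2)))) (fun _ => by fun_prop))
  rw [lintegral_prod_eq_prod_lintegral_of_indepFun Finset.univ _ this (by fun_prop)]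
  have (i : Fin n) : ∫⁻ a, ENNReal.ofReal (Real.exp (-(t * ‖a i‖ ^ 2)))
      ∂(Measure.pi fun _ => complexGaussian v) = ENNReal.ofReal (1 + v * t)⁻¹ := by
    rw [← lintegral_exp_neg_norm_sq_complexGaussian v ht,
      ← (measurePreserving_eval (fun _ => complexGaussian v) i).lintegral_comp (by fun_prop)]
  have h0 : 0 ≤ (1 + v * t)⁻¹ := by positivity
  simp only [this, Finset.prod_const, Finset.card_univ, Fintype.card_fin, ENNReal.ofReal_pow h0]


/-- Write `1 / x` as the integral of `exp (-t x)` over `t > 0` and exchange the integrals. The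
Laplace transform `(1 + v t)⁻¹ ^ n` then has to be integrated, and this converges exactly because `1
< n`. -/
lemma lintegral_inv_norm_sq_gaussianVector_le {n : ℕ} (hn : 1 < n) {v : ℝ≥0} (hv : 0 < v) :
    ∫⁻ z, (ENNReal.ofReal (‖z‖ ^ 2))⁻¹ ∂(gaussianVector n v) ≤
      ENNReal.ofReal (((n : ℝ) - 1) * v)⁻¹ := by
  have hv' : (0 : ℝ) < v := by exact_mod_cast hv
  have hn' : (0 : ℝ) < (n : ℝ) - 1 := by
    have : (1 : ℝ) < n := by exact_mod_cast hn
    linarith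
  have hinv : ∀ z : EuclideanSpace ℂ (Fin n), z ≠ 0 → (ENNReal.ofReal (‖z‖ ^ 2))⁻¹ =
      ∫⁻ t in Set.Ioi (0 : ℝ), ENNReal.ofReal (Real.exp (-(t * ‖z‖ ^ 2))) := by
    intro z hz
    have hz' : 0 < ‖z‖ ^ 2 := by positivity
    have he : ∀ t : ℝ, -(t * ‖z‖ ^ 2) = -‖z‖ ^ 2 * t := fun t => by ring
    rw [← ofReal_integral_eq_lintegral_ofReal _ (ae_of_all _ fun x => (Real.exp_pos _).le)]
    · simp_rw [he]
      rw [integral_exp_mul_Ioi (by linarith), ENNReal.ofReal_inv_of_pos hz' |>.symm]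
      congr 1
      simp [neg_div_neg_eq]
    · simp_rw [he]
      exact integrableOn_exp_mul_Ioi (by linarith) _
  have hinv' : ∀ z : EuclideanSpace ℂ (Fin n), (ENNReal.ofReal (‖z‖ ^ 2))⁻¹ =
      ∫⁻ t in Set.Ioi (0 : ℝ), ENNReal.ofReal (Real.exp (-(t * ‖z‖ ^ 2))) := by
    intro z
    -- At `z = 0` both sides are `∞`.
    rcases eq_or_ne z 0 with rfl | hz
    · simp
    · exact hinv z hz
  simp_rw [hinv']
  rw [lintegral_lintegral_swap (Measurable.aemeasurable (by fun_prop))]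
  rw [setLIntegral_congr_fun measurableSet_Ioi
    (fun t ht => lintegral_exp_neg_norm_sq_gaussianVector n v (le_of_lt ht))]
  have hd : ∀ x ∈ Set.Ici (0 : ℝ), HasDerivAt
      (fun t : ℝ => -((((n : ℝ) - 1) * v)⁻¹ * ((1 + v * t)⁻¹ ^ (n - 1))))
      ((1 + v * x)⁻¹ ^ n) x := by
    intro x hx
    have hx : 0 ≤ x := hx
    have h1 : (1 + v * x : ℝ) ≠ 0 := by positivity
    have := (((((hasDerivAt_id x).const_mul (v : ℝ)).const_add 1).fun_inv h1).fun_pow (n - 1)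
      |>.const_mul (((n : ℝ) - 1) * v)⁻¹).fun_neg
    refine this.congr_deriv ?_
    obtain ⟨m, rfl⟩ : ∃ m, n = m + 2 := ⟨n - 2, by omega⟩
    simp only [id, Nat.add_sub_cancel, show m + 2 - 1 = m + 1 by omega, inv_pow]
    push_cast at hn' ⊢
    have : (m : ℝ) + 2 - 1 ≠ 0 := hn'.ne'
    field_simp
    ring
  have ht : Filter.Tendsto (fun t : ℝ => -((((n : ℝ) - 1) * v)⁻¹ * ((1 + v * t)⁻¹ ^ (n - 1))))
      Filter.atTop (nhds 0) := by
    have h1 : Filter.Tendsto (fun t : ℝ => (1 + v * t)⁻¹) Filter.atTop (nhds 0) :=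
      tendsto_inv_atTop_zero.comp
        (Filter.tendsto_atTop_add_const_left _ _ (Filter.tendsto_id.const_mul_atTop hv'))
    have := ((h1.pow (n - 1)).const_mul (((n : ℝ) - 1) * v)⁻¹).neg
    rwa [zero_pow (by omega), mul_zero, neg_zero] at this
  have hnn : ∀ x ∈ Set.Ioi (0 : ℝ), 0 ≤ (1 + v * x)⁻¹ ^ n := by
    intro x hx
    have hx : 0 < x := hx
    positivity
  rw [← ofReal_integral_eq_lintegral_ofReal
    (integrableOn_Ioi_deriv_of_nonneg' hd hnn ht)
    ((ae_restrict_iff' measurableSet_Ioi).2 (ae_of_all _ hnn)),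
    integral_Ioi_of_hasDerivAt_of_nonneg' hd hnn ht]
  simp

/-- A Gaussian vector is almost surely nonzero. -/
lemma gaussianVector_singleton_zero {n : ℕ} (hn : 0 < n) {v : ℝ≥0} (hv : 0 < v) :
    gaussianVector n v {0} = 0 := by
  have hv' : (0 : ℝ) < v := by exact_mod_cast hv
  -- The integrand of the Laplace transform is `1` at the origin, so an atom there is bounded by the
  -- transform at every `t`, which tends to `0`.
  have h : ∀ t : ℝ, 0 ≤ t → gaussianVector n v {0} ≤ ENNReal.ofReal ((1 + v * t)⁻¹ ^ n) := by
    intro t ht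
    rw [← lintegral_exp_neg_norm_sq_gaussianVector n v ht]
    calc gaussianVector n v {0}
        = ∫⁻ z in {0}, ENNReal.ofReal (Real.exp (-(t * ‖z‖ ^ 2))) ∂(gaussianVector n v) := by
          rw [lintegral_singleton]; simp
      _ ≤ _ := setLIntegral_le_lintegral _ _
  have h1 : Filter.Tendsto (fun t : ℝ => (1 + v * t)⁻¹) Filter.atTop (nhds 0) :=
    tendsto_inv_atTop_zero.comp
      (Filter.tendsto_atTop_add_const_left _ _ (Filter.tendsto_id.const_mul_atTop hv'))
  have h2 := ENNReal.tendsto_ofReal (h1.pow n)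
  rw [zero_pow hn.ne', ENNReal.ofReal_zero] at h2
  exact le_antisymm (ge_of_tendsto h2 ((Filter.eventually_ge_atTop 0).mono h)) zero_le

/-! ### Inverse Gram matrix and distance to a span -/

/-- A diagonal entry of the inverse of the Gram matrix of a linearly independent family is the
inverse of the squared distance of a vector to the span of the other ones. -/
lemma inv_gram_diag {ι E : Type*} [Fintype ι] [DecidableEq ι] [NormedAddCommGroup E]
    [InnerProductSpace ℂ E] [FiniteDimensional ℂ E] {w : ι → E} (hw : LinearIndependent ℂ w)
    {j : ι} {v : Finset.univ.erase j → E} (hv : ∀ i : Finset.univ.erase j, w i = v i) :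
    (Matrix.gram ℂ w)⁻¹ j j =
      (((‖(Submodule.span ℂ (Set.range v))ᗮ.orthogonalProjectionOnto (w j)‖ ^ 2)⁻¹ : ℝ) : ℂ) := by
  obtain rfl : (fun i : Finset.univ.erase j => w i) = v := funext hv
  have hdet : IsUnit (Matrix.gram ℂ w).det :=
    isUnit_iff_ne_zero.2 (Matrix.det_gram_ne_zero_iff_linearIndependent.2 hw)
  set B := (Matrix.gram ℂ w)⁻¹ with hB
  set K := (Submodule.span ℂ (Set.range fun i : Finset.univ.erase j => w i))ᗮ with hK
  -- The `j`-th column of the inverse gives the coefficients of the dual vector `u`, which is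
  -- orthogonal to every `w p` with `p ≠ j` and satisfies `⟪w j, u⟫ = 1`.
  have hdual : ∀ p, ⟪w p, ∑ i, B i j • w i⟫_ℂ = if p = j then 1 else 0 := by
    intro p
    have := congrFun (congrFun (Matrix.mul_nonsing_inv _ hdet) p) j
    rw [Matrix.mul_apply, Matrix.one_apply] at this
    rw [← this, inner_sum]
    refine Finset.sum_congr rfl fun i _ => ?_
    rw [inner_smul_right, Matrix.gram_apply, mul_comm]
  set u := ∑ i, B i j • w i with hu
  have huK : u ∈ K := by
    rw [hK, Submodule.mem_orthogonal]
    intro x hx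
    induction hx using Submodule.span_induction with
    | mem x hx =>
      obtain ⟨i, rfl⟩ := hx
      rw [hdual, if_neg (Finset.ne_of_mem_erase i.2)]
    | zero => simp
    | add x y _ _ hx hy => rw [inner_add_left, hx, hy, add_zero]
    | smul a x _ hx => rw [inner_smul_left, hx, mul_zero]
  have huu : ((‖u‖ ^ 2 : ℝ) : ℂ) = B j j := by
    have h1 : ⟪u, u⟫_ℂ = starRingEnd ℂ (B j j) := by
      conv_lhs => rw [hu, sum_inner]
      simp_rw [inner_smul_left, ← hu, hdual]
      simp
    have h2 := inner_self_eq_norm_sq_to_K (𝕜 := ℂ) u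
    rw [h1] at h2
    have := congrArg (starRingEnd ℂ) h2
    rw [Complex.conj_conj] at this
    rw [this]
    simp
  -- Projecting to `K` fixes `u` and kills every term of its expansion except the `j`-th.
  have hproj : u = B j j • ((K.orthogonalProjectionOnto (w j) : K) : E) := by
    have h1 : K.orthogonalProjectionOnto u = ⟨u, huK⟩ :=
      Submodule.orthogonalProjectionOnto_mem_subspace_eq_self ⟨u, huK⟩
    have h2 : K.orthogonalProjectionOnto u = B j j • K.orthogonalProjectionOnto (w j) := by
      rw [hu, map_sum, Finset.sum_eq_single j]
      · rw [map_smul]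
      · intro i _ hi
        have : K.orthogonalProjectionOnto (w i) = 0 := by
          rw [Submodule.orthogonalProjectionOnto_eq_zero_iff, hK]
          exact Submodule.le_orthogonal_orthogonal _ (Submodule.subset_span
            ⟨⟨i, Finset.mem_erase.2 ⟨hi, Finset.mem_univ i⟩⟩, rfl⟩)
        rw [map_smul, this, smul_zero]
      · simp
    have := congrArg (Subtype.val) (h1.symm.trans h2)
    simpa using this
  have hu0 : u ≠ 0 := by
    intro h
    have := hdual j
    rw [h] at this
    simp at this
  -- Since `B j j = ‖u‖ ^ 2`, taking norms in `hproj` makes `‖u‖` the inverse of the length of the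
  -- projection.
  have hn : ‖u‖ = ‖u‖ ^ 2 * ‖K.orthogonalProjectionOnto (w j)‖ := by
    conv_lhs => rw [hproj, ← huu, norm_smul]
    simp
  have hpos : 0 < ‖u‖ := norm_pos_iff.2 hu0
  rw [← huu]
  congr 1
  have h3 : ‖u‖ * ‖K.orthogonalProjectionOnto (w j)‖ = 1 := by
    have : ‖u‖ * (‖u‖ * ‖K.orthogonalProjectionOnto (w j)‖) = ‖u‖ * 1 := by
      rw [mul_one]; nth_rewrite 3 [hn]; ring
    exact mul_left_cancel₀ hpos.ne' this
  rw [eq_inv_of_mul_eq_one_left h3, inv_pow]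

/-! ### Projection of a Gaussian vector away from a fixed span -/

section Projection

variable {L : ℕ} (K : Submodule ℂ (EuclideanSpace ℂ (Fin L)))

lemma lintegral_comp_norm_orthogonalProjection (v : ℝ≥0) {f : ℝ → ℝ≥0∞} (hf : Measurable f) :
    ∫⁻ g, f (‖K.orthogonalProjectionOnto g‖ ^ 2) ∂(gaussianVector L v) =
      ∫⁻ z, f (‖z‖ ^ 2) ∂(gaussianVector (Module.finrank ℂ K) v) := by
  rw [← map_orthogonalProjection_gaussianVector v K (stdOrthonormalBasis ℂ K),
    lintegral_map (by fun_prop) (by fun_prop)]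
  simp only [LinearIsometryEquiv.norm_map]

lemma ae_orthogonalProjection_ne_zero (hK : 0 < Module.finrank ℂ K) {v : ℝ≥0} (hv : 0 < v) :
    ∀ᵐ g ∂(gaussianVector L v), K.orthogonalProjectionOnto g ≠ 0 := by
  have h := gaussianVector_singleton_zero hK hv
  rw [← map_orthogonalProjection_gaussianVector v K (stdOrthonormalBasis ℂ K),
    Measure.map_apply (by fun_prop) (measurableSet_singleton _)] at h
  filter_upwards [measure_eq_zero_iff_ae_notMem.1 h] with g hg h0
  exact hg (by simp [h0])

end Projection

lemma finrank_orthogonal_span_range {L : ℕ} {κ : Type*} [Fintype κ]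
    {v : κ → EuclideanSpace ℂ (Fin L)} (hv : LinearIndependent ℂ v) :
    Module.finrank ℂ (Submodule.span ℂ (Set.range v))ᗮ = L - Fintype.card κ := by
  have h := Submodule.finrank_add_finrank_orthogonal (Submodule.span ℂ (Set.range v))
  rw [finrank_span_eq_card hv, finrank_euclideanSpace_fin] at h
  omega

/-- A vector of the span has zero projection to the orthogonal complement. The complement has
positive dimension, so a Gaussian projection to it almost surely does not vanish. -/
lemma ae_notMem_span {L : ℕ} {κ : Type*} [Fintype κ] (hκ : Fintype.card κ < L)
    {w : κ → EuclideanSpace ℂ (Fin L)} (hw : LinearIndependent ℂ w) {v : ℝ≥0} (hv : 0 < v) :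
    ∀ᵐ g ∂(gaussianVector L v), g ∉ Submodule.span ℂ (Set.range w) := by
  have h := ae_orthogonalProjection_ne_zero (Submodule.span ℂ (Set.range w))ᗮ
    (by rw [finrank_orthogonal_span_range hw]; omega) hv
  filter_upwards [h] with g hg hmem
  exact hg ((Submodule.orthogonalProjectionOnto_eq_zero_iff).2
    (Submodule.le_orthogonal_orthogonal _ hmem))

/-! ### Independent Gaussian columns: freezing all but one -/

section Columns

variable {Ω ι : Type*} [MeasurableSpace Ω] {μ : Measure Ω} [IsProbabilityMeasure μ]
  [Fintype ι] [DecidableEq ι] {L : ℕ} {X : ι → Ω → EuclideanSpace ℂ (Fin L)} {b : ι → ℝ≥0}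

omit [DecidableEq ι] in
lemma hasLaw_prodMk_columns (hX : ∀ j, HasLaw (X j) (gaussianVector L (b j)) μ)
    (hind : ∀ (j : ι) (S : Finset ι), j ∉ S → IndepFun (fun ω (i : S) => X i ω) (X j) μ)
    {j : ι} {S : Finset ι} (hj : j ∉ S) :
    HasLaw (fun ω => ((fun i : S => X i ω), X j ω))
      ((μ.map fun ω (i : S) => X i ω).prod (gaussianVector L (b j))) μ := by
  have hS : AEMeasurable (fun ω (i : S) => X i ω) μ :=
    aemeasurable_pi_lambda _ fun i => (hX i).aemeasurable
  have := Measure.isProbabilityMeasure_map hS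
  exact (hind j S hj).hasLaw_prod ⟨hS, rfl⟩ (hX j)

lemma measurableSet_linearIndependent (κ : Type*) [Finite κ] :
    MeasurableSet {w : κ → EuclideanSpace ℂ (Fin L) | LinearIndependent ℂ w} :=
  isOpen_setOfPred_linearIndependent.measurableSet

/-- At most `L` independent Gaussian vectors in `ℂ^L` are almost surely linearly independent. -/
lemma ae_linearIndepOn (hX : ∀ j, HasLaw (X j) (gaussianVector L (b j)) μ)
    (hind : ∀ (j : ι) (S : Finset ι), j ∉ S → IndepFun (fun ω (i : S) => X i ω) (X j) μ)
    (hb : ∀ j, 0 < b j) (S : Finset ι) (hS : S.card ≤ L) :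
    ∀ᵐ ω ∂μ, LinearIndepOn ℂ (fun i => X i ω) (S : Set ι) := by
  induction S using Finset.induction_on with
  | empty => simp
  | insert j S hj ih =>
    rw [Finset.card_insert_of_notMem hj] at hS
    have hlaw := hasLaw_prodMk_columns hX hind hj
    have hS' : AEMeasurable (fun ω (i : S) => X i ω) μ :=
      aemeasurable_pi_lambda _ fun i => (hX i).aemeasurable
    have := Measure.isProbabilityMeasure_map hS'
    -- The implication is recast as "`p.1` is dependent, or the family extended by `p.2` is
    -- independent", and linear independence is an open condition.
    have hmeas : MeasurableSet {p : (S → EuclideanSpace ℂ (Fin L)) × EuclideanSpace ℂ (Fin L) |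
        LinearIndependent ℂ p.1 → p.2 ∉ Submodule.span ℂ (Set.range p.1)} := by
      have hm1 : Measurable fun p : (S → EuclideanSpace ℂ (Fin L)) × EuclideanSpace ℂ (Fin L) =>
          p.1 := measurable_fst
      have h1 := (measurableSet_linearIndependent (L := L) S).preimage hm1
      have hm : Measurable fun p : (S → EuclideanSpace ℂ (Fin L)) × EuclideanSpace ℂ (Fin L) =>
          (fun o : Option S => Option.casesOn' o p.2 p.1) := by
        refine measurable_pi_lambda _ fun o => ?_
        cases o with
        | none => exact measurable_snd
        | some i => exact (measurable_pi_apply i).comp measurable_fst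
      have h2 := (measurableSet_linearIndependent (L := L) (Option S)).preimage hm
      convert h1.compl.union h2 using 1
      ext p
      simp only [Set.mem_ofPred_eq, Set.mem_union, Set.mem_compl_iff, Set.mem_preimage,
        linearIndependent_option']
      tauto
    -- By Fubini it suffices to fix the earlier vectors; the new one then almost surely avoids their
    -- span.
    have hae : ∀ᵐ p ∂((μ.map fun ω (i : S) => X i ω).prod (gaussianVector L (b j))),
        LinearIndependent ℂ p.1 → p.2 ∉ Submodule.span ℂ (Set.range p.1) := by
      refine (Measure.ae_prod_mem_iff_ae_ae_mem hmeas).2 (ae_of_all _ fun w => ?_)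
      by_cases hw : LinearIndependent ℂ w
      · filter_upwards [ae_notMem_span (by rw [Fintype.card_coe]; omega) hw (hb j)] with g hg _
        exact hg
      · exact ae_of_all _ fun g h => absurd h hw
    rw [← hlaw.map_eq] at hae
    filter_upwards [ih (by omega), ae_of_ae_map hlaw.aemeasurable hae] with ω h1 h2
    rw [Finset.coe_insert, linearIndepOn_insert (by simpa using hj)]
    refine ⟨h1, ?_⟩
    rw [Set.image_eq_range]
    exact h2 h1

/-- The family with value `p.2` at `j` and the values of `p.1` elsewhere. -/
def insertColumn (j : ι) {E : Type*} (p : (↥(Finset.univ.erase j) → E) × E) (i : ι) : E :=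
  if h : i = j then p.2 else p.1 ⟨i, Finset.mem_erase.2 ⟨h, Finset.mem_univ i⟩⟩

lemma measurable_insertColumn (j : ι) {E : Type*} [MeasurableSpace E] :
    Measurable (insertColumn j (E := E)) := by
  refine measurable_pi_lambda _ fun i => ?_
  by_cases h : i = j
  · simp only [insertColumn, h, dite_true]
    exact measurable_snd
  · simp only [insertColumn, h, dite_false]
    exact (measurable_pi_apply _).comp measurable_fst

lemma insertColumn_self (j : ι) {E : Type*} (p : (↥(Finset.univ.erase j) → E) × E) :
    insertColumn j p j = p.2 := by
  simp [insertColumn]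

lemma insertColumn_coe (j : ι) {E : Type*} (p : (↥(Finset.univ.erase j) → E) × E)
    (i : (Finset.univ.erase j : Finset ι)) : insertColumn j p i = p.1 i := by
  simp [insertColumn, Finset.ne_of_mem_erase i.2]

lemma insertColumn_restrict (j : ι) {E : Type*} (w : ι → E) :
    insertColumn j ((fun i : (Finset.univ.erase j : Finset ι) => w i), w j) = w := by
  ext i
  by_cases h : i = j
  · subst h; simp [insertColumn]
  · simp [insertColumn, h]

lemma linearIndependent_insertColumn {j : ι}
    {p : (↥(Finset.univ.erase j) → EuclideanSpace ℂ (Fin L)) × EuclideanSpace ℂ (Fin L)}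
    (h1 : LinearIndependent ℂ p.1) (h2 : p.2 ∉ Submodule.span ℂ (Set.range p.1)) :
    LinearIndependent ℂ (insertColumn j p) := by
  have hcoe : (fun i : (Finset.univ.erase j : Finset ι) => insertColumn j p i) = p.1 :=
    funext (insertColumn_coe j p)
  have h : LinearIndepOn ℂ (insertColumn j p) (insert j ((Finset.univ.erase j : Finset ι) : Set ι)) := by
    rw [linearIndepOn_insert (by simp)]
    refine ⟨?_, ?_⟩
    · change LinearIndependent ℂ (fun i : (Finset.univ.erase j : Finset ι) => insertColumn j p i)
      rwa [hcoe]
    · rw [Set.image_eq_range, insertColumn_self]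
      change p.2 ∉ Submodule.span ℂ (Set.range
        fun i : (Finset.univ.erase j : Finset ι) => insertColumn j p i)
      rwa [hcoe]
  rw [← Finset.coe_insert, Finset.insert_erase (Finset.mem_univ j), Finset.coe_univ,
    linearIndepOn_univ_iff] at h
  exact h

/-- The formula `det⁻¹ • adjugate` holds at singular matrices too, where the inverse is `0`, so no
restriction to independent families is needed. -/
lemma measurable_inv_gram_diag (j : ι) :
    Measurable fun w : ι → EuclideanSpace ℂ (Fin L) => ((Matrix.gram ℂ w)⁻¹ j j).re := by
  have hg : Continuous fun w : ι → EuclideanSpace ℂ (Fin L) => Matrix.gram ℂ w :=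
    continuous_matrix fun i k => by
      simp only [Matrix.gram_apply]
      fun_prop
  simp_rw [Matrix.inv_def, Ring.inverse_eq_inv', Matrix.smul_apply, smul_eq_mul]
  exact Complex.measurable_re.comp
    (hg.matrix_det.measurable.inv.mul (hg.matrix_adjugate.matrix_elem j j).measurable)

/-- Given the other columns, the entry is the inverse squared norm of a Gaussian vector in their
orthogonal complement, whose dimension is almost surely constant. A general `f` covers the means of
both the entry and its inverse. -/
lemma lintegral_inv_gram_diag_le (hX : ∀ j, HasLaw (X j) (gaussianVector L (b j)) μ)
    (hind : ∀ (j : ι) (S : Finset ι), j ∉ S → IndepFun (fun ω (i : S) => X i ω) (X j) μ)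
    (hb : ∀ j, 0 < b j) (hL : Fintype.card ι ≤ L) (j : ι) {f : ℝ → ℝ≥0∞} (hf : Measurable f) :
    ∫⁻ ω, f ((Matrix.gram ℂ fun i => X i ω)⁻¹ j j).re ∂μ ≤
      ∫⁻ z, f (‖z‖ ^ 2)⁻¹ ∂(gaussianVector (L - Fintype.card ι + 1) (b j)) := by
  have hcard : (Finset.univ.erase j).card = Fintype.card ι - 1 := by
    rw [Finset.card_erase_of_mem (Finset.mem_univ j), Finset.card_univ]
  have hpos : 0 < Fintype.card ι := Fintype.card_pos_iff.2 ⟨j⟩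
  have hlaw := hasLaw_prodMk_columns hX hind (Finset.notMem_erase j Finset.univ)
  have hS : AEMeasurable (fun ω (i : (Finset.univ.erase j : Finset ι)) => X i ω) μ :=
    aemeasurable_pi_lambda _ fun i => (hX i).aemeasurable
  have := Measure.isProbabilityMeasure_map hS
  set F : (↥(Finset.univ.erase j) → EuclideanSpace ℂ (Fin L)) ×
      EuclideanSpace ℂ (Fin L) → ℝ≥0∞ :=
    fun p => f ((Matrix.gram ℂ (insertColumn j p))⁻¹ j j).re with hF
  have hFm : Measurable F :=
    hf.comp ((measurable_inv_gram_diag j).comp (measurable_insertColumn j))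
  have h1 : ∫⁻ ω, f ((Matrix.gram ℂ fun i => X i ω)⁻¹ j j).re ∂μ =
      ∫⁻ p, F p ∂((μ.map fun ω (i : (Finset.univ.erase j : Finset ι)) => X i ω).prod
        (gaussianVector L (b j))) := by
    rw [← hlaw.lintegral_comp hFm.aemeasurable]
    refine lintegral_congr fun ω => ?_
    have := insertColumn_restrict j fun i => X i ω
    simp only [hF, this]
  rw [h1, lintegral_prod _ hFm.aemeasurable]
  have hli : ∀ᵐ w ∂(μ.map fun ω (i : (Finset.univ.erase j : Finset ι)) => X i ω),
      LinearIndependent ℂ w :=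
    (ae_map_iff hS (measurableSet_linearIndependent _)).2
      (ae_linearIndepOn hX hind hb (Finset.univ.erase j) (by omega))
  calc _ ≤ ∫⁻ _, ∫⁻ z, f (‖z‖ ^ 2)⁻¹ ∂(gaussianVector (L - Fintype.card ι + 1) (b j))
        ∂(μ.map fun ω (i : (Finset.univ.erase j : Finset ι)) => X i ω) := by
        refine lintegral_mono_ae ?_
        filter_upwards [hli] with w hw
        -- The `+ 1` in the dimension appears because only the columns other than `j` are projected
        -- out.
        have hrank := finrank_orthogonal_span_range hw
        rw [Fintype.card_coe, hcard, show L - (Fintype.card ι - 1) = L - Fintype.card ι + 1 by omega]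
          at hrank
        rw [← hrank, ← lintegral_comp_norm_orthogonalProjection _ _ (f := fun x => f x⁻¹)
          (hf.comp measurable_inv)]
        refine le_of_eq (lintegral_congr_ae ?_)
        filter_upwards [ae_notMem_span (by rw [Fintype.card_coe]; omega) hw (hb j)] with g hg
        have := inv_gram_diag (linearIndependent_insertColumn (p := (w, g)) hw hg)
          (insertColumn_coe j (w, g))
        simp only [insertColumn_self] at this
        simp only [hF, this, Complex.ofReal_re]
    _ = _ := by simp

end Columns

/-! ### Zero-forcing within one group -/

section Group

variable {Q L : ℕ} {m : Fin Q → ℕ}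

/-- The column of `H_ψ` that belongs to the stream `j`, as a vector of `ℂ^L`. -/
def column (H : (k : Fin Q) → Matrix (Fin L) (Fin (m k)) ℂ) (j : Stream m) :
    EuclideanSpace ℂ (Fin L) :=
  WithLp.toLp 2 fun l => H j.1 l j.2

/-- The transpose reflects that the inner product is conjugate-linear in its first argument; it does
not affect the diagonal of the inverse. -/
lemma transpose_mul_conjMatrix_groupChannel (H : (k : Fin Q) → Matrix (Fin L) (Fin (m k)) ℂ) :
    (groupChannel H)ᵀ * conjMatrix (groupChannel H) = (Matrix.gram ℂ (column H))ᵀ := by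
  ext i p
  simp [Matrix.mul_apply, PiLp.inner_apply, column, groupChannel, conjMatrix]

lemma invGram_diag (H : (k : Fin Q) → Matrix (Fin L) (Fin (m k)) ℂ) (j : Stream m) :
    invGram H j j = (Matrix.gram ℂ (column H))⁻¹ j j := by
  rw [invGram, transpose_mul_conjMatrix_groupChannel, ← Matrix.transpose_nonsing_inv,
    Matrix.transpose_apply]

lemma isUnit_det_of_linearIndependent {H : (k : Fin Q) → Matrix (Fin L) (Fin (m k)) ℂ}
    (h : LinearIndependent ℂ (column H)) :
    IsUnit ((groupChannel H)ᵀ * conjMatrix (groupChannel H)).det := by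
  rw [transpose_mul_conjMatrix_groupChannel, Matrix.det_transpose, isUnit_iff_ne_zero]
  exact Matrix.det_gram_ne_zero_iff_linearIndependent.2 h

lemma invGram_diag_re_pos {H : (k : Fin Q) → Matrix (Fin L) (Fin (m k)) ℂ}
    (h : LinearIndependent ℂ (column H)) (j : Stream m) : 0 < (invGram H j j).re := by
  rw [invGram_diag]
  open scoped ComplexOrder in
  have := (Matrix.posDef_gram_of_linearIndependent h).inv.diag_pos (i := j)
  exact (Complex.lt_def.1 this).1

/-- The Gram matrix cancels its inverse, leaving only the column normalization on the diagonal. -/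
lemma transpose_groupChannel_mul_zfPrecoder {H : (k : Fin Q) → Matrix (Fin L) (Fin (m k)) ℂ}
    (h : LinearIndependent ℂ (column H)) (i j : Stream m) :
    ((groupChannel H)ᵀ * zfPrecoder H) i j =
      if i = j then (((invGram H j j).re ^ (-(1 / 2) : ℝ) : ℝ) : ℂ) else 0 := by
  have h1 := congrFun (congrFun (Matrix.mul_nonsing_inv _ (isUnit_det_of_linearIndependent h)) i) j
  rw [← invGram, Matrix.mul_assoc, Matrix.mul_apply, Matrix.one_apply] at h1
  simp only [Matrix.mul_apply, zfPrecoder, Matrix.hadamard_apply, Matrix.of_apply] at h1 ⊢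
  simp_rw [← mul_assoc]
  rw [← Finset.sum_mul, h1]
  simp

end Group

/-! ### SINR under zero-forcing -/

section System

variable {Ψ : Type*} [Fintype Ψ] [DecidableEq Ψ] {Q L : ℕ} {M : Ψ → Fin Q → ℕ}

/-- The other groups cancel exactly, whatever their precoders are, so nothing has to be assumed
about their channels. -/
lemma decodingSignal_one (H : Channel L M) (V : (ψ : Ψ) → Matrix (Fin L) (Stream (M ψ)) ℂ)
    (P : Symbol M → ℝ) (s : Symbol M → ℂ) (ψ : Ψ) (k : Fin Q) (z : Fin (M ψ k) → ℂ) :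
    decodingSignal H V P s ψ k 1 z = (H ψ k)ᵀ *ᵥ groupSignal V P s ψ + z := by
  rw [decodingSignal, receivedSignal, interGroupInterference, transmitSignal,
    ← Finset.add_sum_erase _ _ (Finset.mem_univ ψ), Matrix.mulVec_add, Matrix.conjTranspose_one,
    Matrix.one_mulVec]
  abel

lemma noiseGain_one (H : Channel L M) (V : (ψ : Ψ) → Matrix (Fin L) (Stream (M ψ)) ℂ)
    (P : Symbol M → ℝ) (ψ : Ψ) (k : Fin Q) (q r : Fin (M ψ k)) :
    noiseGain H V P ψ k 1 q r = if q = r then 1 else 0 := by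
  have h : groupSignal V P 0 ψ = 0 := by
    simp [groupSignal, ← Pi.zero_def]
  rw [noiseGain, decodingSignal_one, h, Matrix.mulVec_zero, zero_add, Pi.single_apply]

lemma symbolGain_zf {H : Channel L M} {ψ : Ψ} (h : LinearIndependent ℂ (column (H ψ)))
    (P : Symbol M → ℝ) (k : Fin Q) (q : Fin (M ψ k)) (i : Symbol M) :
    symbolGain H (fun φ => zfPrecoder (H φ)) P ψ k 1 q i =
      if i = ⟨ψ, k, q⟩ then
        (((invGram (H ψ) ⟨k, q⟩ ⟨k, q⟩).re ^ (-(1 / 2) : ℝ) : ℝ) : ℂ) * (√(P i) : ℂ)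
      else 0 := by
  have h1 : symbolGain H (fun φ => zfPrecoder (H φ)) P ψ k 1 q i =
      (((groupChannel (H ψ))ᵀ * zfPrecoder (H ψ)) *ᵥ fun j => (√(P ⟨ψ, j⟩) : ℂ) *
        (Pi.single i 1 : Symbol M → ℂ) ⟨ψ, j⟩) ⟨k, q⟩ := by
    rw [symbolGain, decodingSignal_one, add_zero, groupSignal, ← Matrix.mulVec_mulVec]
    rfl
  rw [h1, Matrix.mulVec, dotProduct]
  simp_rw [transpose_groupChannel_mul_zfPrecoder h]
  rw [Finset.sum_eq_single ⟨k, q⟩]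
  · rw [if_pos rfl, Pi.single_apply]
    by_cases hi : i = ⟨ψ, k, q⟩
    · subst hi; simp
    · simp [hi, Ne.symm hi]
  · intro j _ hj
    rw [if_neg (Ne.symm hj), zero_mul]
  · simp

lemma sinr_zf {H : Channel L M} {ψ : Ψ} (h : LinearIndependent ℂ (column (H ψ)))
    {P : Symbol M → ℝ} (hP : ∀ i, 0 ≤ P i) (N₀ : ℝ) (k : Fin Q) (q : Fin (M ψ k)) :
    sinr H (fun φ => zfPrecoder (H φ)) P N₀ ψ k 1 q =
      P ⟨ψ, k, q⟩ / N₀ / (invGram (H ψ) ⟨k, q⟩ ⟨k, q⟩).re := by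
  have hpos := invGram_diag_re_pos h ⟨k, q⟩
  have hs : ∑ i ∈ Finset.univ.erase (⟨ψ, k, q⟩ : Symbol M),
      ‖symbolGain H (fun φ => zfPrecoder (H φ)) P ψ k 1 q i‖ ^ 2 = 0 := by
    refine Finset.sum_eq_zero fun i hi => ?_
    rw [symbolGain_zf h, if_neg (Finset.ne_of_mem_erase hi)]
    simp
  have hn : ∑ r, ‖noiseGain H (fun φ => zfPrecoder (H φ)) P ψ k 1 q r‖ ^ 2 = 1 := by
    simp_rw [noiseGain_one]
    rw [Finset.sum_eq_single q] <;> simp +contextual [eq_comm]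
  rw [sinr, hs, hn, symbolGain_zf h, if_pos rfl, norm_mul, Complex.norm_real, Complex.norm_real,
    mul_pow, Real.norm_of_nonneg (Real.rpow_nonneg hpos.le _),
    Real.norm_of_nonneg (Real.sqrt_nonneg _), Real.sq_sqrt (hP _), ← Real.rpow_natCast,
    ← Real.rpow_mul hpos.le]
  -- The exponent `-(1 / 2) * 2` becomes `-1`.
  norm_num
  rw [Real.rpow_neg_one]
  field_simp

/-! ### Rayleigh fading: laws of the columns and the two mean bounds -/

section Fading

variable {Ω : Type*} [MeasurableSpace Ω] {μ : Measure Ω} {H : Ω → Channel L M}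
  {β : Ψ → Fin Q → ℝ}

omit [Fintype Ψ] [DecidableEq Ψ] in
lemma IsRayleighFading.iIndepFun_group (hH : IsRayleighFading H β μ) (ψ : Ψ) :
    iIndepFun (fun (p : Stream (M ψ) × Fin L) (ω : Ω) => H ω ψ p.1.1 p.2 p.1.2) μ := by
  refine hH.indep.precomp (g := fun p : Stream (M ψ) × Fin L =>
    (⟨ψ, p.1.1, p.2, p.1.2⟩ : (ψ : Ψ) × (k : Fin Q) × (Fin L × Fin (M ψ k)))) ?_
  rintro ⟨⟨k, q⟩, l⟩ ⟨⟨k', q'⟩, l'⟩ h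
  simp only [Sigma.mk.injEq, heq_eq_eq, true_and] at h
  obtain ⟨rfl, h⟩ := h
  simp only [heq_eq_eq, Prod.mk.injEq] at h
  obtain ⟨rfl, rfl⟩ := h
  rfl

omit [Fintype Ψ] [DecidableEq Ψ] in
lemma IsRayleighFading.hasLaw_column (hH : IsRayleighFading H β μ) (ψ : Ψ) (j : Stream (M ψ)) :
    HasLaw (fun ω => column (H ω ψ) j) (gaussianVector L (β ψ j.1).toNNReal) μ := by
  have h1 : iIndepFun (fun (l : Fin L) (ω : Ω) => H ω ψ j.1 l j.2) μ :=
    (hH.iIndepFun_group ψ).precomp (g := fun l : Fin L => (j, l)) (Prod.mk_right_injective j)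
  have h2 := h1.hasLaw_pi fun l => hH.hasLaw ψ j.1 l j.2
  exact HasLaw.comp (Y := WithLp.toLp 2) ⟨by fun_prop, rfl⟩ h2

omit [Fintype Ψ] [DecidableEq Ψ] in
lemma IsRayleighFading.indepFun_column (hH : IsRayleighFading H β μ) (ψ : Ψ) (j : Stream (M ψ))
    (S : Finset (Stream (M ψ))) (hj : j ∉ S) :
    IndepFun (fun ω (i : S) => column (H ω ψ) i) (fun ω => column (H ω ψ) j) μ := by
  have h := (hH.iIndepFun_group ψ).indepFun_finset₀ (S ×ˢ Finset.univ) ({j} ×ˢ Finset.univ)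
    (Finset.disjoint_product.2 (Or.inl (by simpa using hj)))
    (fun p => (hH.hasLaw ψ p.1.1 p.2 p.1.2).aemeasurable)
  exact h.comp
    (φ := fun w (i : S) => WithLp.toLp 2 fun l =>
      w ⟨((i : Stream (M ψ)), l), Finset.mem_product.2 ⟨i.2, Finset.mem_univ _⟩⟩)
    (ψ := fun w => WithLp.toLp 2 fun l =>
      w ⟨(j, l), Finset.mem_product.2 ⟨Finset.mem_singleton_self j, Finset.mem_univ _⟩⟩)
    (measurable_pi_lambda _ fun i => (by fun_prop)) (by fun_prop)

omit [Fintype Ψ] [DecidableEq Ψ] in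
lemma IsRayleighFading.aemeasurable_invGram_diag (hH : IsRayleighFading H β μ) (ψ : Ψ)
    (j : Stream (M ψ)) : AEMeasurable (fun ω => (invGram (H ω ψ) j j).re) μ := by
  simp_rw [invGram_diag]
  exact (measurable_inv_gram_diag j).comp_aemeasurable
    (aemeasurable_pi_lambda _ fun i => (hH.hasLaw_column ψ i).aemeasurable)

variable [IsProbabilityMeasure μ]

omit [Fintype Ψ] [DecidableEq Ψ] in
lemma IsRayleighFading.ae_linearIndependent_column (hH : IsRayleighFading H β μ)
    (hβ : ∀ ψ k, 0 < β ψ k) {ψ : Ψ} (hL : ∑ k, M ψ k ≤ L) :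
    ∀ᵐ ω ∂μ, LinearIndependent ℂ (column (H ω ψ)) := by
  have h := ae_linearIndepOn (hH.hasLaw_column ψ) (hH.indepFun_column ψ)
    (fun j => Real.toNNReal_pos.2 (hβ ψ j.1)) Finset.univ (by simpa using hL)
  filter_upwards [h] with ω hω
  rwa [Finset.coe_univ, linearIndepOn_univ_iff] at hω

omit [Fintype Ψ] [DecidableEq Ψ] in
lemma IsRayleighFading.lintegral_inv_invGram_diag_le (hH : IsRayleighFading H β μ)
    (hβ : ∀ ψ k, 0 < β ψ k) {ψ : Ψ} (hL : ∑ k, M ψ k ≤ L) (j : Stream (M ψ)) :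
    ∫⁻ ω, ENNReal.ofReal (invGram (H ω ψ) j j).re⁻¹ ∂μ ≤
      ENNReal.ofReal (((L : ℝ) - (∑ k, (M ψ k : ℝ)) + 1) * β ψ j.1) := by
  have hcard : Fintype.card (Stream (M ψ)) = ∑ k, M ψ k := by simp
  have h := lintegral_inv_gram_diag_le (hH.hasLaw_column ψ) (hH.indepFun_column ψ)
    (fun j => Real.toNNReal_pos.2 (hβ ψ j.1)) (hcard.trans_le hL) j
    (f := fun x => ENNReal.ofReal x⁻¹) (by fun_prop)
  simp_rw [inv_inv, lintegral_norm_sq_gaussianVector, hcard] at h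
  simp_rw [invGram_diag]
  refine h.trans_eq ?_
  rw [ENNReal.ofReal_mul' (hβ ψ j.1).le, ← Nat.cast_sum, ← Nat.cast_sub hL,
    ENNReal.ofReal_add (by positivity) zero_le_one, ENNReal.ofReal_natCast, ENNReal.ofReal_one]
  push_cast
  rfl

omit [Fintype Ψ] [DecidableEq Ψ] in
-- The strict inequality makes the projected dimension at least `2`, as the inverse moment requires.
lemma IsRayleighFading.lintegral_invGram_diag_le (hH : IsRayleighFading H β μ)
    (hβ : ∀ ψ k, 0 < β ψ k) {ψ : Ψ} (hL : ∑ k, M ψ k < L) (j : Stream (M ψ)) :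
    ∫⁻ ω, ENNReal.ofReal (invGram (H ω ψ) j j).re ∂μ ≤
      ENNReal.ofReal (((L : ℝ) - (∑ k, (M ψ k : ℝ))) * β ψ j.1)⁻¹ := by
  have hcard : Fintype.card (Stream (M ψ)) = ∑ k, M ψ k := by simp
  have h := lintegral_inv_gram_diag_le (hH.hasLaw_column ψ) (hH.indepFun_column ψ)
    (fun j => Real.toNNReal_pos.2 (hβ ψ j.1)) (hcard.trans_le hL.le) j
    (f := fun x => ENNReal.ofReal x) (by fun_prop)
  simp_rw [invGram_diag]
  refine h.trans ?_
  have h2 := lintegral_inv_norm_sq_gaussianVector_le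
    (n := L - Fintype.card (Stream (M ψ)) + 1) (by omega) (Real.toNNReal_pos.2 (hβ ψ j.1))
  rw [Real.coe_toNNReal _ (hβ ψ j.1).le, hcard, Nat.cast_add, Nat.cast_sub hL.le, Nat.cast_one,
    add_sub_cancel_right, Nat.cast_sum] at h2
  rw [hcard]
  refine le_trans (lintegral_mono_ae ?_) h2
  refine ae_of_all _ fun z => ?_
  -- At `z = 0` the real inverse is `0` and the extended one is `∞`, so only an inequality holds.
  rcases eq_or_ne z 0 with rfl | hz
  · simp
  · exact (ENNReal.ofReal_inv_of_pos (by positivity)).le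

end Fading

end System

/-! ### Jensen's inequality through tangent lines -/

/-- The tangent line of the concave function `x ↦ log (1 + c x)`, for the argument `y⁻¹`. -/
lemma log_one_add_div_le {c y x₀ : ℝ} (hc : 0 ≤ c) (hy : 0 < y) (hx : 0 ≤ x₀) :
    Real.log (1 + c / y) ≤ Real.log (1 + c * x₀) + c / (1 + c * x₀) * (y⁻¹ - x₀) := by
  have h0 : 0 < 1 + c * x₀ := by positivity
  have h1 : 0 < 1 + c / y := by positivity
  have h := Real.log_le_sub_one_of_pos (div_pos h1 h0)
  rw [Real.log_div h1.ne' h0.ne'] at h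
  have : (1 + c / y) / (1 + c * x₀) - 1 = c / (1 + c * x₀) * (y⁻¹ - x₀) := by
    field_simp
    ring
  linarith

/-- The tangent line of the convex function `y ↦ log (1 + c / y)`. -/
lemma le_log_one_add_div {c y y₀ : ℝ} (hc : 0 ≤ c) (hy : 0 < y) (hy₀ : 0 < y₀) :
    Real.log (1 + c / y₀) + c / (y₀ * (y₀ + c)) * (y₀ - y) ≤ Real.log (1 + c / y) := by
  have h0 : 0 < 1 + c / y₀ := by positivity
  have h1 : 0 < 1 + c / y := by positivity
  have h := Real.log_le_sub_one_of_pos (div_pos h0 h1)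
  rw [Real.log_div h0.ne' h1.ne'] at h
  have : c / (y₀ * (y₀ + c)) * (y₀ - y) ≤ 1 - (1 + c / y₀) / (1 + c / y) := by
    -- The gap to the tangent line is an explicit nonnegative multiple of a square.
    have e : 1 - (1 + c / y₀) / (1 + c / y) - c / (y₀ * (y₀ + c)) * (y₀ - y) =
        c * (y₀ - y) ^ 2 / (y₀ * (y₀ + c) * (y + c)) := by
      field_simp
      ring
    have : 0 ≤ c * (y₀ - y) ^ 2 / (y₀ * (y₀ + c) * (y + c)) := by positivity
    linarith
  linarith

section Jensen

variable {Ω : Type*} [MeasurableSpace Ω] {μ : Measure Ω}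

lemma integrable_of_lintegral_ofReal_le {f : Ω → ℝ} (hf : AEMeasurable f μ)
    (h0 : 0 ≤ᵐ[μ] f) {C : ℝ} (h : ∫⁻ ω, ENNReal.ofReal (f ω) ∂μ ≤ ENNReal.ofReal C) :
    Integrable f μ :=
  (lintegral_ofReal_ne_top_iff_integrable hf.aestronglyMeasurable h0).1
    (ne_top_of_le_ne_top ENNReal.ofReal_ne_top h)

lemma integral_le_of_lintegral_ofReal_le {f : Ω → ℝ} (hf : AEMeasurable f μ)
    (h0 : 0 ≤ᵐ[μ] f) {C : ℝ} (hC : 0 ≤ C)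
    (h : ∫⁻ ω, ENNReal.ofReal (f ω) ∂μ ≤ ENNReal.ofReal C) :
    ∫ ω, f ω ∂μ ≤ C := by
  rw [integral_eq_lintegral_of_nonneg_ae h0 hf.aestronglyMeasurable]
  exact ENNReal.toReal_le_of_le_ofReal hC h

variable [IsProbabilityMeasure μ] {Y : Ω → ℝ} {c : ℝ}

omit [IsProbabilityMeasure μ] in
lemma integrable_log_one_add_div (hc : 0 ≤ c) (hY : AEMeasurable Y μ) (hpos : ∀ᵐ ω ∂μ, 0 < Y ω)
    {x₀ : ℝ} (h : ∫⁻ ω, ENNReal.ofReal (Y ω)⁻¹ ∂μ ≤ ENNReal.ofReal x₀) :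
    Integrable (fun ω => Real.log (1 + c / Y ω)) μ := by
  have hi := integrable_of_lintegral_ofReal_le hY.inv
    (by filter_upwards [hpos] with ω hω using (inv_pos.2 hω).le) h
  refine (hi.const_mul c).mono'
    (Real.measurable_log.comp_aemeasurable ((hY.const_div c).const_add 1)).aestronglyMeasurable ?_
  filter_upwards [hpos] with ω hω
  rw [Real.norm_of_nonneg (Real.log_nonneg (by
    have : 0 ≤ c / Y ω := by positivity
    linarith))]
  -- The tangent at `x₀ = 0` gives the integrable majorant `c / y`.
  simpa using log_one_add_div_le hc hω le_rfl

lemma integral_log_one_add_div_le (hc : 0 ≤ c) (hY : AEMeasurable Y μ) (hpos : ∀ᵐ ω ∂μ, 0 < Y ω)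
    {x₀ : ℝ} (hx : 0 ≤ x₀) (h : ∫⁻ ω, ENNReal.ofReal (Y ω)⁻¹ ∂μ ≤ ENNReal.ofReal x₀) :
    ∫ ω, Real.log (1 + c / Y ω) ∂μ ≤ Real.log (1 + c * x₀) := by
  have h0 : 0 ≤ᵐ[μ] fun ω => (Y ω)⁻¹ := by filter_upwards [hpos] with ω hω using (inv_pos.2 hω).le
  have hi : Integrable (fun ω => (Y ω)⁻¹) μ := integrable_of_lintegral_ofReal_le hY.inv h0 h
  have hle : ∫ ω, (Y ω)⁻¹ ∂μ ≤ x₀ := integral_le_of_lintegral_ofReal_le hY.inv h0 hx h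
  have hi' : Integrable (fun ω => c / (1 + c * x₀) * ((Y ω)⁻¹ - x₀)) μ :=
    (hi.sub (integrable_const _)).const_mul _
  calc ∫ ω, Real.log (1 + c / Y ω) ∂μ
      ≤ ∫ ω, (Real.log (1 + c * x₀) + c / (1 + c * x₀) * ((Y ω)⁻¹ - x₀)) ∂μ :=
        integral_mono_ae (integrable_log_one_add_div hc hY hpos h)
          ((integrable_const _).add hi')
          (by filter_upwards [hpos] with ω hω using log_one_add_div_le hc hω hx)
    _ = Real.log (1 + c * x₀) + c / (1 + c * x₀) * (∫ ω, (Y ω)⁻¹ ∂μ - x₀) := by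
        rw [integral_add (integrable_const _) hi', integral_const_mul,
          integral_sub hi (integrable_const _)]
        simp
    _ ≤ _ := by
        have h1 : 0 ≤ c / (1 + c * x₀) := by positivity
        have h2 : ∫ ω, (Y ω)⁻¹ ∂μ - x₀ ≤ 0 := sub_nonpos.2 hle
        linarith [mul_nonpos_of_nonneg_of_nonpos h1 h2]

/-- Integrability is a separate hypothesis: a bound on the mean of `Y` does not control `log (1 + c
/ Y)` near `Y = 0`. -/
lemma le_integral_log_one_add_div (hc : 0 ≤ c) (hY : AEMeasurable Y μ) (hpos : ∀ᵐ ω ∂μ, 0 < Y ω)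
    {y₀ : ℝ} (hy : 0 < y₀) (h : ∫⁻ ω, ENNReal.ofReal (Y ω) ∂μ ≤ ENNReal.ofReal y₀)
    (hlog : Integrable (fun ω => Real.log (1 + c / Y ω)) μ) :
    Real.log (1 + c / y₀) ≤ ∫ ω, Real.log (1 + c / Y ω) ∂μ := by
  have h0 : 0 ≤ᵐ[μ] Y := by filter_upwards [hpos] with ω hω using hω.le
  have hi := integrable_of_lintegral_ofReal_le hY h0 h
  have hle := integral_le_of_lintegral_ofReal_le hY h0 hy.le h
  have hi' : Integrable (fun ω => c / (y₀ * (y₀ + c)) * (y₀ - Y ω)) μ :=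
    ((integrable_const _).sub hi).const_mul _
  calc Real.log (1 + c / y₀)
      ≤ Real.log (1 + c / y₀) + c / (y₀ * (y₀ + c)) * (y₀ - ∫ ω, Y ω ∂μ) := by
        have h1 : 0 ≤ c / (y₀ * (y₀ + c)) := by positivity
        linarith [mul_nonneg h1 (sub_nonneg.2 hle)]
    _ = ∫ ω, (Real.log (1 + c / y₀) + c / (y₀ * (y₀ + c)) * (y₀ - Y ω)) ∂μ := by
        rw [integral_add (integrable_const _) hi', integral_const_mul,
          integral_sub (integrable_const _) hi]
        simp
    _ ≤ _ := integral_mono_ae ((integrable_const _).add hi') hlog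
        (by filter_upwards [hpos] with ω hω using le_log_one_add_div hc hω hy)

end Jensen

end VCC

/-! ### The rate bounds -/

theorem proposition1 {Ω : Type*} [MeasurableSpace Ω] (μ : Measure Ω) [IsProbabilityMeasure μ]
    {Ψ : Type*} [Fintype Ψ] [DecidableEq Ψ] {Q L : ℕ} {M : Ψ → Fin Q → ℕ}
    (H : Ω → VCC.Channel L M) (β : Ψ → Fin Q → ℝ) (P : VCC.Symbol M → ℝ) (N₀ Θ T : ℝ)
    (hβ : ∀ ψ k, 0 < β ψ k) (hP : ∀ i, 0 ≤ P i) (hN₀ : 0 < N₀)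
    (hT : 0 < T) (hΘ : Θ * (∑ ψ, ∑ k, (M ψ k : ℝ)) ≤ T)
    (hH : VCC.IsRayleighFading H β μ)
    (ψ : Ψ) (k : Fin Q) (hL : ∑ k', M ψ k' ≤ L) :
    Integrable (fun ω => VCC.zfRate (H ω) P N₀ Θ T ψ k) μ ∧
      VCC.zfLowerBound L β P N₀ Θ T ψ k ≤ VCC.zfAverageRate μ H P N₀ Θ T ψ k ∧
      VCC.zfAverageRate μ H P N₀ Θ T ψ k ≤ VCC.zfUpperBound L β P N₀ Θ T ψ k := by
  have hξ : 0 ≤ VCC.csiFactor M Θ T := by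
    rw [VCC.csiFactor, sub_nonneg]
    exact div_le_one_of_le₀ hΘ hT.le
  have hli := hH.ae_linearIndependent_column hβ hL
  have hc : ∀ q, 0 ≤ P ⟨ψ, k, q⟩ / N₀ := fun q => div_nonneg (hP _) hN₀.le
  have hY := fun q : Fin (M ψ k) => hH.aemeasurable_invGram_diag ψ ⟨k, q⟩
  have hpos : ∀ q : Fin (M ψ k), ∀ᵐ ω ∂μ, 0 < (VCC.invGram (H ω ψ) ⟨k, q⟩ ⟨k, q⟩).re := fun q => by
    filter_upwards [hli] with ω hω using VCC.invGram_diag_re_pos hω _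
  have hup := fun q : Fin (M ψ k) => hH.lintegral_inv_invGram_diag_le hβ hL ⟨k, q⟩
  have hlog := fun q => VCC.integrable_log_one_add_div (hc q) (hY q) (hpos q) (hup q)
  have hrate : (fun ω => VCC.zfRate (H ω) P N₀ Θ T ψ k) =ᵐ[μ] fun ω => VCC.csiFactor M Θ T *
      ∑ q, Real.log (1 + P ⟨ψ, k, q⟩ / N₀ / (VCC.invGram (H ω ψ) ⟨k, q⟩ ⟨k, q⟩).re) := by
    filter_upwards [hli] with ω hω
    simp only [VCC.zfRate, VCC.sinr_zf hω hP]
  have havg : VCC.zfAverageRate μ H P N₀ Θ T ψ k = VCC.csiFactor M Θ T * ∑ q,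
      ∫ ω, Real.log (1 + P ⟨ψ, k, q⟩ / N₀ / (VCC.invGram (H ω ψ) ⟨k, q⟩ ⟨k, q⟩).re) ∂μ := by
    rw [VCC.zfAverageRate, integral_congr_ae hrate, integral_const_mul,
      integral_finsetSum _ fun q _ => hlog q]
  have hcast : (∑ k', (M ψ k' : ℝ)) ≤ L := by exact_mod_cast hL
  refine ⟨((integrable_finsetSum _ fun q _ => hlog q).const_mul _).congr hrate.symm, ?_, ?_⟩
  · rw [havg, VCC.zfLowerBound]
    refine mul_le_mul_of_nonneg_left (Finset.sum_le_sum fun q _ => ?_) hξ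
    -- When `M_ψ = L` the projection is one-dimensional and the inverse-moment bound is unavailable,
    -- but the lower bound is then `log 1 = 0`.
    rcases hL.lt_or_eq with hlt | heq
    · have hlt' : 0 < (L : ℝ) - ∑ k', (M ψ k' : ℝ) := sub_pos.2 (by exact_mod_cast hlt)
      have h := VCC.le_integral_log_one_add_div (hc q) (hY q) (hpos q)
        (inv_pos.2 (mul_pos hlt' (hβ ψ k))) (hH.lintegral_invGram_diag_le hβ hlt ⟨k, q⟩) (hlog q)
      refine le_of_eq_of_le ?_ h
      rw [div_inv_eq_mul]
      congr 2
      ring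
    · have h0 : (L : ℝ) - ∑ k', (M ψ k' : ℝ) = 0 := by
        rw [← heq, Nat.cast_sum, sub_self]
      rw [h0, mul_zero, zero_mul, zero_div, add_zero, Real.log_one]
      refine integral_nonneg_of_ae ?_
      filter_upwards [hpos q] with ω hω
      have := div_nonneg (hc q) hω.le
      exact Real.log_nonneg (by linarith)
  · rw [havg, VCC.zfUpperBound]
    refine mul_le_mul_of_nonneg_left (Finset.sum_le_sum fun q _ => ?_) hξ
    have h := VCC.integral_log_one_add_div_le (hc q) (hY q) (hpos q)
      (mul_nonneg (by linarith) (hβ ψ k).le) (hup q)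
    refine h.trans_eq ?_
    congr 2
    ring
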